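/- Let $X=\{X(t),\,t\ge 0\}$ be a time-homogeneous continuous-time Markov process on a probability space, with finite state space $E$, whose paths are almost surely right-continuous with left limits. Let $P_{i,j}(t)$, $i,j\in E$, be its transition probability functions: each $\mathbf P(t)=(P_{i,j}(t))_{i,j\in E}$ is a stochastic matrix, $\mathbf P(0)$ is the identity matrix, and, for all $s,t\ge 0$, given $X(s)=i$ and the states at any finitely many times not later than $s$, the conditional probability of $X(s+t)=j$ is $P_{i,j}(t)$ (whenever the conditioning event has positive probability). Let $\alpha_i=\mathbb P[X(0)=i]$ be the initial probabilities, and let $\mathbf Q=(q_{i,j})_{i,j\in E}$ be the generator matrix: $q_{i,j}\ge 0$ for $i\ne j$, $q_{i,i}=-\sum_{j\neq i}q_{i,j}$, and $$q_{i,j}=\lim_{t\to 0^+}\frac{P_{i,j}(t)}{t}\quad(i\neq j),\qquad q_{i,i}=\lim_{t\to 0^+}\frac{P_{i,i}(t)-1}{t}.$$ Let $E=W\cup F$ be a partition of $E$ into two disjoint sets, the working states $W$ and the failure states $F$, and let $N_r(t)$ be the number of repairs up to time $t$, that is, the number of times $u\in(0,t]$ with $X(u-)\in F$ and $X(u)\in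 W$. Then, for every $t\ge 0$, $N_r(t)$ is almost surely finite and integrable, and the rate of occurrence of repairs $$\mathrm{ror}(t):=\lim_{\Delta t\to 0}\frac{\mathbb E[N_r(t+\Delta t)-N_r(t)]}{\Delta t}$$ (where $\Delta t\neq 0$ and $t+\Delta t\ge 0$, so that the limit is two-sided for $t>0$ and one-sided for $t=0$) exists and is given by $$\mathrm{ror}(t)=\sum_{i\in E}\sum_{f\in F}\sum_{w\in W}\alpha_i\,\big(e^{t\mathbf Q}\big)_{i,f}\,q_{f,w}.$$ -/

import Mathlib

open MeasureTheory ProbabilityTheory Filter Topology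
open scoped NNReal

namespace MarkovReliability

/-- A path with values in a (discrete, finite) state space that is right-continuous and has
left limits at all positive times. Convergence in the discrete topology is eventual equality. -/
structure IsCadlagPath {E : Type*} (x : ℝ≥0 → E) : Prop where
  right_continuous : ∀ t : ℝ≥0, ∀ᶠ u in 𝓝[>] t, x u = x t
  left_limit : ∀ t : ℝ≥0, 0 < t → ∃ i : E, ∀ᶠ u in 𝓝[<] t, x u = i

/-- `X` is a time-homogeneous continuous-time Markov process on the probability space `(Ω, μ)`
with finite state space `E` and transition probability functions `P t i j`. -/
structure IsMarkovProcess {Ω E : Type*} [MeasurableSpace Ω] [Fintype E] [DecidableEq E]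
    (μ : Measure Ω) (X : ℝ≥0 → Ω → E) (P : ℝ≥0 → Matrix E E ℝ) : Prop where
  /-- Every `X t` is a random variable. -/
  measurableSet_eq : ∀ (t : ℝ≥0) (i : E), MeasurableSet {ω | X t ω = i}
  /-- Almost all paths are right-continuous with left limits. -/
  ae_cadlag : ∀ᵐ ω ∂μ, IsCadlagPath (fun t => X t ω)
  nonneg : ∀ (t : ℝ≥0) (i j : E), 0 ≤ P t i j
  sum_eq_one : ∀ (t : ℝ≥0) (i : E), ∑ j, P t i j = 1
  zero_eq_one : P 0 = 1
  /-- Markov property and time homogeneity: given `X s = i` and the states at finitely many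
  times `u k ≤ s`, the conditional probability of `X (s + t) = j` is `P t i j`, whenever the
  conditioning event has positive probability (with `n = 0` this is `ℙ[X (s + t) = j | X s = i]`,
  and with `n = 0`, `s = 0` it is `ℙ[X t = j | X 0 = i]`). -/
  markov : ∀ (s t : ℝ≥0) (i j : E) (n : ℕ) (u : Fin n → ℝ≥0) (x : Fin n → E),
    (∀ k, u k ≤ s) →
    μ {ω | X s ω = i ∧ ∀ k, X (u k) ω = x k} ≠ 0 →
    (μ[|{ω | X s ω = i ∧ ∀ k, X (u k) ω = x k}]).real {ω | X (s + t) ω = j} = P t i j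

/-- `Q` is the generator matrix of the transition probability functions `P`: a matrix with
nonnegative off-diagonal entries and `q i i = -∑_{j ≠ i} q i j`, whose entries are the
transition rates of `P` at time zero. -/
structure IsGenerator {E : Type*} [Fintype E] [DecidableEq E]
    (P : ℝ≥0 → Matrix E E ℝ) (Q : Matrix E E ℝ) : Prop where
  nonneg : ∀ i j : E, i ≠ j → 0 ≤ Q i j
  diag : ∀ i : E, Q i i = -∑ j ∈ Finset.univ.erase i, Q i j
  tendsto_off_diag : ∀ i j : E, i ≠ j →
    Tendsto (fun t : ℝ≥0 => P t i j / (t : ℝ)) (𝓝[>] 0) (𝓝 (Q i j))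
  tendsto_diag : ∀ i : E,
    Tendsto (fun t : ℝ≥0 => (P t i i - 1) / (t : ℝ)) (𝓝[>] 0) (𝓝 (Q i i))

/-- The times in `(0, t]` at which the path `x` makes a transition from `A` to `B`, that is, at
which its left limit lies in `A` and its value lies in `B`. -/
def transitionTimes {E : Type*} (x : ℝ≥0 → E) (A B : Finset E) (t : ℝ≥0) : Set ℝ≥0 :=
  {u | 0 < u ∧ u ≤ t ∧ (∃ a ∈ A, ∀ᶠ v in 𝓝[<] u, x v = a) ∧ x u ∈ B}

/-- The counting process `N_r t` of repairs up to time `t`: the number of transitions from the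
failure states `F` to the working states `W` during `(0, t]`. -/
noncomputable def numRepairs {Ω E : Type*} (X : ℝ≥0 → Ω → E) (F W : Finset E)
    (t : ℝ≥0) (ω : Ω) : ℕ :=
  (transitionTimes (fun s => X s ω) F W t).ncard

/-- The rate of occurrence of repairs at time `t` exists and equals `r`: the quotients
`𝔼[N_r (t + Δ) - N_r t] / Δ` tend to `r` as `Δ → 0`, where `Δ ≠ 0` ranges over all
increments (of both signs if `0 < t`) with `0 ≤ t + Δ`. -/
def HasROCOR {Ω E : Type*} [MeasurableSpace Ω] (μ : Measure Ω) (X : ℝ≥0 → Ω → E)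
    (F W : Finset E) (t : ℝ≥0) (r : ℝ) : Prop :=
  Tendsto
    (fun Δ : ℝ =>
      (∫ ω, ((numRepairs X F W (Real.toNNReal (t + Δ)) ω : ℝ) - (numRepairs X F W t ω : ℝ)) ∂μ)
        / Δ)
    (𝓝[{Δ : ℝ | Δ ≠ 0 ∧ 0 ≤ (t : ℝ) + Δ}] 0) (𝓝 r)

end MarkovReliability

/-! Sample the path on the grid of mesh `t / 2 ^ n` and count the steps from `F` to `W`. Since `W ∪
F` is everything, halving the mesh never lowers the count (`monotone_gridCrossings_dyadic`); for a
càdlàg path it is eventually the true number of repairs (`eventually_ncard_transitionTimes`).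
Monotone convergence thus makes `𝔼 N_r(t)` the limit of the expected grid counts. By the Markov
property these are sums of `law f * P h f w`, and `P h f w = h * Q f w + o(h)` turns them into
Riemann sums converging to the integral over `[0, t]` of `∑ law f * Q f w`
(`tendsto_integral_gridCrossings`). The forward equation gives `law = α exp(sQ)` (`law_eq_exp`), so
the integrand is continuous, and the fundamental theorem of calculus yields the rate. -/

namespace MarkovReliability

/-! ### Càdlàg paths and dyadic counting -/

section Paths

variable {E : Type*}

lemma IsCadlagPath.eventually_nhds {x : ℝ≥0 → E} (hx : IsCadlagPath x) (c : ℝ≥0) :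
    ∃ i : E, ∀ᶠ u in 𝓝 c, (u < c → x u = i) ∧ (c < u → x u = x c) := by
  have hr := eventually_nhdsWithin_iff.1 (hx.right_continuous c)
  rcases eq_or_lt_of_le (zero_le (a := c)) with rfl | hc
  · exact ⟨x 0, hr.mono fun u hu => ⟨fun h => absurd h not_lt_zero, hu⟩⟩
  · obtain ⟨i, hi⟩ := hx.left_limit c hc
    exact ⟨i, (eventually_nhdsWithin_iff.1 hi).and hr⟩

variable [DecidableEq E]

/-- The indicator of the event that the path `x` is in `A` at time `a` and in `B` at time `b`. -/
def crossing (x : ℝ≥0 → E) (A B : Finset E) (a b : ℝ≥0) : ℕ :=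
  if x a ∈ A ∧ x b ∈ B then 1 else 0

/-- The number of transitions from `A` to `B` seen on the grid `0, h, 2 h, …, m h`. -/
def gridCrossings (x : ℝ≥0 → E) (A B : Finset E) (h : ℝ≥0) (m : ℕ) : ℕ :=
  ∑ k ∈ Finset.range m, crossing x A B (k * h) ((k + 1 : ℕ) * h)

/-- The intermediate state lies in `B`, so the first half crosses, or in `A`, so the second does. -/
lemma crossing_le_add [Fintype E] (x : ℝ≥0 → E) {A B : Finset E} (hcover : B ∪ A = Finset.univ)
    (a b c : ℝ≥0) : crossing x A B a c ≤ crossing x A B a b + crossing x A B b c := by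
  have hb : x b ∈ B ∨ x b ∈ A := by
    rw [← Finset.mem_union, hcover]; exact Finset.mem_univ _
  unfold crossing
  split_ifs <;> first | omega | tauto

lemma gridCrossings_le_half [Fintype E] (x : ℝ≥0 → E) {A B : Finset E}
    (hcover : B ∪ A = Finset.univ) (h : ℝ≥0) (m : ℕ) :
    gridCrossings x A B h m ≤ gridCrossings x A B (h / 2) (2 * m) := by
  induction m with
  | zero => simp [gridCrossings]
  | succ m ih =>
    have h1 : ((2 * m : ℕ) : ℝ≥0) * (h / 2) = m * h := by push_cast; field_simp
    have h2 : ((2 * m + 1 + 1 : ℕ) : ℝ≥0) * (h / 2) = (m + 1 : ℕ) * h := by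
      push_cast; field_simp; ring
    have key := crossing_le_add x hcover (m * h) ((2 * m + 1 : ℕ) * (h / 2)) ((m + 1 : ℕ) * h)
    unfold gridCrossings at ih ⊢
    rw [show 2 * (m + 1) = 2 * m + 1 + 1 by ring, Finset.sum_range_succ, Finset.sum_range_succ,
      Finset.sum_range_succ, h1, h2]
    omega

lemma monotone_gridCrossings_dyadic [Fintype E] (x : ℝ≥0 → E) {A B : Finset E}
    (hcover : B ∪ A = Finset.univ) (t : ℝ≥0) :
    Monotone fun n : ℕ => gridCrossings x A B (t / 2 ^ n) (2 ^ n) := by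
  refine monotone_nat_of_le_succ fun n => ?_
  have := gridCrossings_le_half x hcover (t / 2 ^ n) (2 ^ n)
  rwa [div_div, ← pow_succ, ← pow_succ'] at this

/-- The path is constant on each side of `c`, so only `c` can be a transition time. The half-open
interval matters: `c` is counted exactly when `a < c ≤ b`, which is when the endpoints see both
sides of the jump. -/
lemma encard_transitionTimes_inter_Ioc_of_local {x : ℝ≥0 → E} {A B : Finset E}
    (hdisj : Disjoint B A) {t a b c : ℝ≥0} {i : E} (hab : a ≤ b) (hbt : b ≤ t)
    (hc : ∀ u ∈ Set.Icc a b, (u < c → x u = i) ∧ (c < u → x u = x c)) :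
    (transitionTimes x A B t ∩ Set.Ioc a b).encard = crossing x A B a b := by
  have hAB : ∀ j, j ∈ A → j ∈ B → False := fun j hA hB => Finset.disjoint_left.1 hdisj hB hA
  have left : ∀ {u v : ℝ≥0} {j k : E}, v < u → (∀ w ∈ Set.Ioo v u, x w = j) →
      (∀ᶠ w in 𝓝[<] u, x w = k) → j = k := by
    intro u v j k hvu hj hk
    have : (𝓝[<] u).NeBot := nhdsLT_neBot_of_exists_lt ⟨v, hvu⟩
    obtain ⟨w, hw1, hw2⟩ := (hk.and (Ioo_mem_nhdsLT hvu)).exists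
    exact (hj w hw2).symm.trans hw1
  have hmem : ∀ u, u ∈ transitionTimes x A B t ∩ Set.Ioc a b →
      u = c ∧ i ∈ A ∧ x c ∈ B ∧ a < c ∧ c ≤ b := by
    rintro u ⟨⟨hu0, hut, ⟨k, hkA, hk⟩, huB⟩, hau, hub⟩
    -- Away from `c` the left limit equals the value, which disjointness forbids at a transition.
    rcases lt_trichotomy u c with huc | rfl | huc
    · have : i = k := left hau
        (fun w hw => (hc w ⟨hw.1.le, hw.2.le.trans hub⟩).1 (hw.2.trans huc)) hk
      rw [(hc u ⟨hau.le, hub⟩).1 huc, this] at huB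
      exact (hAB _ hkA huB).elim
    · have : i = k := left hau
        (fun w hw => (hc w ⟨hw.1.le, hw.2.le.trans hub⟩).1 hw.2) hk
      exact ⟨rfl, this ▸ hkA, huB, hau, hub⟩
    · have : x c = k := left (max_lt hau huc)
        (fun w hw => (hc w ⟨(le_max_left _ _).trans hw.1.le, hw.2.le.trans hub⟩).2
          ((le_max_right _ _).trans_lt hw.1)) hk
      rw [(hc u ⟨hau.le, hub⟩).2 huc, this] at huB
      exact (hAB _ hkA huB).elim
  have ha := hc a ⟨le_rfl, hab⟩
  have hb := hc b ⟨hab, le_rfl⟩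
  by_cases hcab : a < c ∧ c ≤ b
  · have hxa := ha.1 hcab.1
    have hxb : x b = x c := by
      rcases eq_or_lt_of_le hcab.2 with h | h
      · rw [h]
      · exact hb.2 h
    by_cases hcr : i ∈ A ∧ x c ∈ B
    · have : transitionTimes x A B t ∩ Set.Ioc a b = {c} := by
        ext u
        refine ⟨fun hu => (hmem u hu).1, ?_⟩
        rintro rfl
        refine ⟨⟨(zero_le (a := a)).trans_lt hcab.1, hcab.2.trans hbt, ⟨i, hcr.1, ?_⟩, hcr.2⟩, hcab⟩
        filter_upwards [Ioo_mem_nhdsLT hcab.1] with w hw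
        exact (hc w ⟨hw.1.le, hw.2.le.trans hcab.2⟩).1 hw.2
      rw [this, crossing, hxa, hxb, if_pos hcr]; simp
    · have : transitionTimes x A B t ∩ Set.Ioc a b = ∅ :=
        Set.eq_empty_of_forall_notMem fun u hu => hcr ⟨(hmem u hu).2.1, (hmem u hu).2.2.1⟩
      rw [this, crossing, hxa, hxb, if_neg hcr]; simp
  · have : transitionTimes x A B t ∩ Set.Ioc a b = ∅ :=
      Set.eq_empty_of_forall_notMem fun u hu => hcab (hmem u hu).2.2.2
    have hxab : x a = x b := by
      by_cases hac : a < c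
      · rw [ha.1 hac, hb.1 (not_le.1 fun h => hcab ⟨hac, h⟩)]
      · rcases eq_or_lt_of_le (not_lt.1 hac) with rfl | h
        · rcases eq_or_lt_of_le hab with rfl | h
          · rfl
          · exact (hb.2 h).symm
        · rw [ha.2 h, hb.2 (h.trans_le hab)]
    rw [this, crossing, if_neg]
    · simp
    · rintro ⟨h1, h2⟩
      exact hAB _ h1 (hxab ▸ h2)

/-- Compactness of `[0, t]`: a Lebesgue number for the neighbourhoods of `eventually_nhds` puts
every short interval inside one of them. -/
lemma IsCadlagPath.exists_pos_encard_inter_Ioc {x : ℝ≥0 → E} (hx : IsCadlagPath x)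
    {A B : Finset E} (hdisj : Disjoint B A) (t : ℝ≥0) :
    ∃ δ > 0, ∀ a b : ℝ≥0, a ≤ b → b ≤ t → dist a b < δ →
      (transitionTimes x A B t ∩ Set.Ioc a b).encard = crossing x A B a b := by
  choose i hi using hx.eventually_nhds
  obtain ⟨V, hV, hVU⟩ := lebesgue_number_lemma_nhds (isCompact_Icc (a := (0 : ℝ≥0)) (b := t))
    (fun c _ => hi c)
  obtain ⟨δ, hδ, hδV⟩ := Metric.mem_uniformity_dist.1 hV
  refine ⟨δ, hδ, fun a b hab hbt hd => ?_⟩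
  obtain ⟨c, hc⟩ := hVU a ⟨zero_le, hab.trans hbt⟩
  refine encard_transitionTimes_inter_Ioc_of_local hdisj hab hbt (c := c) (i := i c) fun u hu => ?_
  refine hc (hδV (lt_of_le_of_lt ?_ hd))
  rw [NNReal.dist_eq, NNReal.dist_eq, abs_sub_comm, abs_sub_comm (a : ℝ)]
  have h1 : (a : ℝ) ≤ u := hu.1
  have h2 : (u : ℝ) ≤ b := hu.2
  rw [abs_of_nonneg (by linarith), abs_of_nonneg (by linarith)]
  linarith

lemma encard_transitionTimes_inter_eq_gridCrossings {x : ℝ≥0 → E} {A B : Finset E}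
    {t h : ℝ≥0} {m : ℕ}
    (hloc : ∀ k < m, (transitionTimes x A B t ∩ Set.Ioc (k * h) ((k + 1 : ℕ) * h)).encard =
      crossing x A B (k * h) ((k + 1 : ℕ) * h)) :
    (transitionTimes x A B t ∩ Set.Ioc 0 (m * h)).encard = gridCrossings x A B h m := by
  induction m with
  | zero => simp [gridCrossings]
  | succ m ih =>
    have hle : (m : ℝ≥0) * h ≤ (m + 1 : ℕ) * h := by gcongr; omega
    rw [← Set.Ioc_union_Ioc_eq_Ioc zero_le hle, Set.inter_union_distrib_left,
      Set.encard_union_eq, ih fun k hk => hloc k (by omega), hloc m (by omega), gridCrossings,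
      gridCrossings, Finset.sum_range_succ, Nat.cast_add (R := ℕ∞)]
    refine Set.disjoint_left.2 ?_
    rintro u ⟨-, hu⟩ ⟨-, hu'⟩
    exact absurd hu'.1 (not_lt.2 hu.2)

/-- The transition times of a càdlàg path are finite in number, and all of them are seen on
sufficiently fine dyadic grids. -/
lemma IsCadlagPath.eventually_encard_transitionTimes {x : ℝ≥0 → E} (hx : IsCadlagPath x)
    {A B : Finset E} (hdisj : Disjoint B A) (t : ℝ≥0) :
    ∀ᶠ n : ℕ in atTop,
      (transitionTimes x A B t).encard = gridCrossings x A B (t / 2 ^ n) (2 ^ n) := by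
  obtain ⟨δ, hδ, H⟩ := hx.exists_pos_encard_inter_Ioc hdisj t
  have hlim : Tendsto (fun n : ℕ => (t : ℝ) / 2 ^ n) atTop (𝓝 0) :=
    tendsto_const_nhds.div_atTop (tendsto_pow_atTop_atTop_of_one_lt one_lt_two)
  filter_upwards [hlim.eventually_lt_const hδ] with n hn
  have hmul : ((2 ^ n : ℕ) : ℝ≥0) * (t / 2 ^ n) = t := by push_cast; field_simp
  rw [← encard_transitionTimes_inter_eq_gridCrossings (t := t), hmul,
    Set.inter_eq_left.2 (show transitionTimes x A B t ⊆ Set.Ioc 0 t from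
      fun u hu => ⟨hu.1, hu.2.1⟩)]
  intro k hk
  refine H _ _ (by gcongr; omega) ?_ ?_
  · calc ((k + 1 : ℕ) : ℝ≥0) * (t / 2 ^ n) ≤ (2 ^ n : ℕ) * (t / 2 ^ n) := by gcongr; omega
      _ = t := hmul
  · rw [NNReal.dist_eq, abs_sub_comm]
    push_cast
    rwa [show ((k : ℝ) + 1) * (t / 2 ^ n) - k * (t / 2 ^ n) = t / 2 ^ n by ring,
      abs_of_nonneg (by positivity)]

lemma IsCadlagPath.finite_transitionTimes {x : ℝ≥0 → E} (hx : IsCadlagPath x)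
    {A B : Finset E} (hdisj : Disjoint B A) (t : ℝ≥0) : (transitionTimes x A B t).Finite := by
  obtain ⟨n, hn⟩ := (hx.eventually_encard_transitionTimes hdisj t).exists
  exact Set.finite_of_encard_eq_coe hn

lemma IsCadlagPath.eventually_ncard_transitionTimes {x : ℝ≥0 → E} (hx : IsCadlagPath x)
    {A B : Finset E} (hdisj : Disjoint B A) (t : ℝ≥0) :
    ∀ᶠ n : ℕ in atTop,
      (transitionTimes x A B t).ncard = gridCrossings x A B (t / 2 ^ n) (2 ^ n) := by
  filter_upwards [hx.eventually_encard_transitionTimes hdisj t] with n hn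
  rw [Set.ncard, hn, ENat.toNat_natCast]

end Paths

/-! ### Monotone convergence, Riemann sums, matrix exponential -/

section Analysis

lemma integrable_and_integral_eq_of_monotone_tendsto {Ω : Type*} [MeasurableSpace Ω]
    {μ : Measure Ω} {f : ℕ → Ω → ℝ} {g : Ω → ℝ} {c : ℝ} (hf : ∀ n, Integrable (f n) μ)
    (hpos : ∀ n ω, 0 ≤ f n ω) (hmono : ∀ ω, Monotone fun n => f n ω)
    (hlim : ∀ᵐ ω ∂μ, Tendsto (fun n => f n ω) atTop (𝓝 (g ω)))
    (hc : Tendsto (fun n => ∫ ω, f n ω ∂μ) atTop (𝓝 c)) :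
    Integrable g μ ∧ ∫ ω, g ω ∂μ = c := by
  have hg : AEStronglyMeasurable g μ :=
    aestronglyMeasurable_of_tendsto_ae _ (fun n => (hf n).aestronglyMeasurable) hlim
  have hg0 : 0 ≤ᵐ[μ] g := by
    filter_upwards [hlim] with ω hω
    exact ge_of_tendsto' hω fun n => hpos n ω
  have hc0 : 0 ≤ c := ge_of_tendsto' hc fun n => integral_nonneg (hpos n)
  have h1 := lintegral_tendsto_of_tendsto_of_monotone (μ := μ)
    (f := fun n ω => ENNReal.ofReal (f n ω)) (F := fun ω => ENNReal.ofReal (g ω))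
    (fun n => (hf n).aestronglyMeasurable.aemeasurable.ennreal_ofReal)
    (ae_of_all _ fun ω n m hnm => ENNReal.ofReal_le_ofReal (hmono ω hnm))
    (hlim.mono fun ω hω => (ENNReal.continuous_ofReal.tendsto _).comp hω)
  have h2 : Tendsto (fun n => ∫⁻ ω, ENNReal.ofReal (f n ω) ∂μ) atTop (𝓝 (ENNReal.ofReal c)) := by
    simp_rw [fun n => (ofReal_integral_eq_lintegral_ofReal (hf n) (ae_of_all _ (hpos n))).symm]
    exact (ENNReal.continuous_ofReal.tendsto _).comp hc
  have h3 := tendsto_nhds_unique h1 h2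
  refine ⟨⟨hg, (hasFiniteIntegral_iff_ofReal hg0).2 (h3 ▸ ENNReal.ofReal_lt_top)⟩, ?_⟩
  rw [integral_eq_lintegral_of_nonneg_ae hg0 hg, h3, ENNReal.toReal_ofReal hc0]

lemma tendsto_dyadic_mesh (t : ℝ) : Tendsto (fun n : ℕ => t / 2 ^ n) atTop (𝓝 0) :=
  tendsto_const_nhds.div_atTop (tendsto_pow_atTop_atTop_of_one_lt one_lt_two)

lemma tendsto_dyadic_riemann_sum {g : ℝ → ℝ} (hg : Continuous g) {t : ℝ} (ht : 0 ≤ t) :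
    Tendsto (fun n : ℕ => ∑ k ∈ Finset.range (2 ^ n), t / 2 ^ n * g (k * (t / 2 ^ n))) atTop
      (𝓝 (∫ s in (0 : ℝ)..t, g s)) := by
  rw [Metric.tendsto_atTop']
  intro ε hε
  have huc := (isCompact_Icc (a := (0 : ℝ)) (b := t)).uniformContinuousOn_of_continuous
    hg.continuousOn
  -- Dividing by `t + 1` covers `t = 0` and makes the total error `ε * t / (t + 1)` strictly less
  -- than `ε`.
  obtain ⟨δ, hδ, H⟩ := Metric.uniformContinuousOn_iff_le.1 huc (ε / (t + 1)) (by positivity)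
  obtain ⟨N, hN⟩ := eventually_atTop.1 ((tendsto_dyadic_mesh t).eventually_lt_const hδ)
  refine ⟨N, fun n hn => ?_⟩
  have hh := hN n hn.le
  set h := t / 2 ^ n with hdef
  have hh0 : 0 ≤ h := by positivity
  have hmul : ((2 ^ n : ℕ) : ℝ) * h = t := by rw [hdef]; push_cast; field_simp
  have hint : ∫ s in (0 : ℝ)..t, g s
      = ∑ k ∈ Finset.range (2 ^ n), ∫ s in (k * h)..((k + 1 : ℕ) * h), g s := by
    rw [intervalIntegral.sum_integral_adjacent_intervals (a := fun k : ℕ => (k : ℝ) * h)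
      fun k _ => hg.intervalIntegrable _ _, hmul]
    simp
  rw [hint, Real.dist_eq, ← Finset.sum_sub_distrib]
  have hterm : ∀ k ∈ Finset.range (2 ^ n),
      |h * g (k * h) - ∫ s in (k * h)..((k + 1 : ℕ) * h), g s| ≤ ε / (t + 1) * h := by
    intro k hk
    have hkn : ((k + 1 : ℕ) : ℝ) * h ≤ t := by
      rw [← hmul]; gcongr; exact Finset.mem_range.1 hk
    have hk1 : ((k + 1 : ℕ) : ℝ) * h = k * h + h := by push_cast; ring
    have hk0 : 0 ≤ (k : ℝ) * h := by positivity
    have hconst : h * g (k * h) = ∫ s in (k * h)..((k + 1 : ℕ) * h), g (k * h) := by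
      rw [intervalIntegral.integral_const, hk1, smul_eq_mul]; ring
    rw [hconst, ← intervalIntegral.integral_sub (by simp) (hg.intervalIntegrable _ _),
      ← Real.norm_eq_abs]
    refine (intervalIntegral.norm_integral_le_of_norm_le_const (C := ε / (t + 1))
      fun s hs => ?_).trans ?_
    · rw [Set.uIoc_of_le (by linarith)] at hs
      rw [← dist_eq_norm]
      refine H _ ⟨hk0, by linarith⟩ _ ⟨hk0.trans hs.1.le, hs.2.trans hkn⟩ ?_
      rw [Real.dist_eq, abs_sub_comm, abs_of_nonneg (by linarith [hs.1])]
      linarith [hs.2]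
    · rw [hk1, show (k : ℝ) * h + h - k * h = h by ring, abs_of_nonneg hh0]
  calc _ ≤ ∑ k ∈ Finset.range (2 ^ n), ε / (t + 1) * h :=
        (Finset.abs_sum_le_sum_abs _ _).trans (Finset.sum_le_sum hterm)
    _ = ε / (t + 1) * t := by
        rw [Finset.sum_const, Finset.card_range, nsmul_eq_mul, mul_left_comm, hmul]
    _ < ε := by
        rw [div_mul_eq_mul_div, div_lt_iff₀ (by linarith)]
        nlinarith

lemma hasDerivAt_matrix_exp_apply {E : Type*} [Fintype E] [DecidableEq E] (Q : Matrix E E ℝ)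
    (i j : E) (t : ℝ) :
    HasDerivAt (fun s : ℝ => NormedSpace.exp (s • Q) i j)
      ((NormedSpace.exp (t • Q) * Q) i j) t := by
  let _ : NormedRing (Matrix E E ℝ) := Matrix.linftyOpNormedRing
  let _ : NormedAlgebra ℝ (Matrix E E ℝ) := Matrix.linftyOpNormedAlgebra
  exact (Matrix.entryLinearMap ℝ ℝ i j).toContinuousLinearMap.hasFDerivAt.comp_hasDerivAt t
    (hasDerivAt_exp_smul_const (𝕂 := ℝ) Q t)

end Analysis

/-! ### The distribution of `X t` and the forward equation -/

section Law

/-- The distribution of `X t`, as a row vector. -/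
noncomputable def law {Ω E : Type*} [MeasurableSpace Ω] (μ : Measure Ω) (X : ℝ≥0 → Ω → E)
    (t : ℝ≥0) (i : E) : ℝ :=
  μ.real {ω | X t ω = i}

lemma law_nonneg {Ω E : Type*} [MeasurableSpace Ω] {μ : Measure Ω} {X : ℝ≥0 → Ω → E}
    (t : ℝ≥0) (i : E) : 0 ≤ law μ X t i := measureReal_nonneg

lemma law_le_one {Ω E : Type*} [MeasurableSpace Ω] {μ : Measure Ω} [IsProbabilityMeasure μ]
    {X : ℝ≥0 → Ω → E} (t : ℝ≥0) (i : E) : law μ X t i ≤ 1 := measureReal_le_one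

variable {Ω E : Type*} [MeasurableSpace Ω] [Fintype E] [DecidableEq E]
  {μ : Measure Ω} [IsProbabilityMeasure μ]
  {X : ℝ≥0 → Ω → E} {P : ℝ≥0 → Matrix E E ℝ} {Q : Matrix E E ℝ}

/-- Conditioning on a null event says nothing about `P`, but then both sides vanish. -/
lemma IsMarkovProcess.measureReal_inter (hX : IsMarkovProcess μ X P) (s t : ℝ≥0) (i j : E) :
    μ.real ({ω | X s ω = i} ∩ {ω | X (s + t) ω = j}) = law μ X s i * P t i j := by
  by_cases h0 : μ {ω | X s ω = i} = 0
  · rw [law, Measure.real, Measure.real, h0, measure_inter_null_of_null_left _ h0]; simp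
  · have h := hX.markov s t i j 0 Fin.elim0 Fin.elim0 (fun k => k.elim0) (by simpa using h0)
    simp only [IsEmpty.forall_iff, and_true] at h
    rw [← h, law, Measure.real, Measure.real, Measure.real,
      ← cond_mul_eq_inter (hX.measurableSet_eq s i), ENNReal.toReal_mul, mul_comm]

lemma IsMarkovProcess.law_add (hX : IsMarkovProcess μ X P) (s t : ℝ≥0) (j : E) :
    law μ X (s + t) j = ∑ i, law μ X s i * P t i j := by
  have hU : {ω | X (s + t) ω = j}
      = ⋃ i ∈ Finset.univ, ({ω | X s ω = i} ∩ {ω | X (s + t) ω = j}) := by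
    ext ω; simp
  rw [law, hU, measureReal_biUnion_finset]
  · exact Finset.sum_congr rfl fun i _ => hX.measureReal_inter s t i j
  · intro i _ k _ hik
    refine Set.disjoint_left.2 ?_
    rintro ω ⟨hi, -⟩ ⟨hk, -⟩
    exact hik (hi.symm.trans hk)
  · exact fun i _ => (hX.measurableSet_eq _ _).inter (hX.measurableSet_eq _ _)

lemma IsGenerator.tendsto (hQ : IsGenerator P Q) (i j : E) :
    Tendsto (fun t : ℝ≥0 => (P t i j - (1 : Matrix E E ℝ) i j) / (t : ℝ)) (𝓝[>] 0)
      (𝓝 (Q i j)) := by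
  by_cases hij : i = j
  · subst hij; simpa using hQ.tendsto_diag i
  · simpa [hij] using hQ.tendsto_off_diag i j hij

lemma IsGenerator.tendsto_transition (hQ : IsGenerator P Q) (h0 : P 0 = 1) (i j : E) :
    Tendsto (fun t : ℝ≥0 => P t i j - (1 : Matrix E E ℝ) i j) (𝓝 0) (𝓝 0) := by
  have hpure : Tendsto (fun t : ℝ≥0 => P t i j - (1 : Matrix E E ℝ) i j) (pure 0) (𝓝 0) := by
    simpa [h0] using tendsto_pure_nhds (fun t : ℝ≥0 => P t i j - (1 : Matrix E E ℝ) i j) 0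
  rw [← nhdsNE_sup_pure, tendsto_sup]
  refine ⟨?_, hpure⟩
  have hne : (𝓝[≠] (0 : ℝ≥0)) = 𝓝[>] 0 := by
    congr 1; ext u; simp [pos_iff_ne_zero]
  rw [hne]
  have ht : Tendsto (fun t : ℝ≥0 => (t : ℝ)) (𝓝[>] 0) (𝓝 0) :=
    (NNReal.continuous_coe.tendsto' 0 0 rfl).mono_left nhdsWithin_le_nhds
  have := (hQ.tendsto i j).mul ht
  rw [mul_zero] at this
  refine this.congr' ?_
  filter_upwards [self_mem_nhdsWithin] with t ht
  have : (t : ℝ) ≠ 0 := by exact_mod_cast (ne_of_gt ht)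
  field_simp

lemma IsMarkovProcess.law_add_sub (hX : IsMarkovProcess μ X P) (s t : ℝ≥0) (j : E) :
    law μ X (s + t) j - law μ X s j
      = ∑ i, law μ X s i * (P t i j - (1 : Matrix E E ℝ) i j) := by
  simp [hX.law_add, mul_sub, Finset.sum_sub_distrib, Matrix.one_apply]

/-- The increment over a step `u` is at most `∑ i, |P u i j - δ_ij|`, uniformly in the starting
time; this gives continuity from the left as well as from the right. -/
lemma IsMarkovProcess.continuous_law (hX : IsMarkovProcess μ X P) (hQ : IsGenerator P Q) (j : E) :
    Continuous fun t => law μ X t j := by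
  refine UniformContinuous.continuous (Metric.uniformContinuous_iff.2 fun ε hε => ?_)
  have hlim : Tendsto (fun t : ℝ≥0 => ∑ i, |P t i j - (1 : Matrix E E ℝ) i j|) (𝓝 0) (𝓝 0) := by
    simpa using tendsto_finsetSum Finset.univ
      fun i _ => (hQ.tendsto_transition hX.zero_eq_one i j).abs
  obtain ⟨δ, hδ, H⟩ := Metric.eventually_nhds_iff.1 (hlim.eventually_lt_const hε)
  refine ⟨δ, hδ, fun {a b} hab => ?_⟩
  wlog hle : b ≤ a generalizing a b
  · rw [dist_comm] at hab ⊢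
    exact this hab (le_of_not_ge hle)
  obtain ⟨u, rfl⟩ := exists_add_of_le hle
  have hu : dist u 0 < δ := by simpa [NNReal.dist_eq] using hab
  rw [Real.dist_eq, hX.law_add_sub]
  refine lt_of_le_of_lt ((Finset.abs_sum_le_sum_abs _ _).trans (Finset.sum_le_sum ?_)) (H hu)
  intro i _
  rw [abs_mul, abs_of_nonneg (law_nonneg _ _)]
  exact mul_le_of_le_one_left (abs_nonneg _) (law_le_one _ _)

/-- Kolmogorov's forward equation, with a right derivative because the generator describes `P` as
time decreases to zero. -/
lemma IsMarkovProcess.hasDerivWithinAt_law (hX : IsMarkovProcess μ X P) (hQ : IsGenerator P Q)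
    {t : ℝ} (ht : 0 ≤ t) (j : E) :
    HasDerivWithinAt (fun r : ℝ => law μ X r.toNNReal j)
      (∑ i, law μ X t.toNNReal i * Q i j) (Set.Ici t) t := by
  rw [hasDerivWithinAt_iff_tendsto_slope, Set.Ici_sdiff_left]
  have hshift : Tendsto (fun r : ℝ => (r - t).toNNReal) (𝓝[>] t) (𝓝[>] 0) := by
    refine tendsto_nhdsWithin_iff.2 ⟨?_, ?_⟩
    · exact ((continuous_real_toNNReal.comp (continuous_id.sub continuous_const)).tendsto' t 0
        (by simp)).mono_left nhdsWithin_le_nhds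
    · filter_upwards [self_mem_nhdsWithin] with r hr
      simpa using hr
  have hlim := tendsto_finsetSum Finset.univ fun i _ =>
    ((hQ.tendsto i j).comp hshift).const_mul (law μ X t.toNNReal i)
  refine hlim.congr' ?_
  filter_upwards [self_mem_nhdsWithin] with r hr
  have hrt : 0 < r - t := sub_pos.2 hr
  have hadd : r.toNNReal = t.toNNReal + (r - t).toNNReal := by
    rw [← Real.toNNReal_add ht hrt.le]; congr 1; ring
  rw [slope_def_field, hadd, hX.law_add_sub, Finset.sum_div]
  refine Finset.sum_congr rfl fun i _ => ?_
  simp only [Function.comp, Real.coe_toNNReal _ hrt.le]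
  ring

/-- The distribution of `X t` is the initial distribution times `exp (t Q)`. -/
lemma IsMarkovProcess.law_eq_exp (hX : IsMarkovProcess μ X P) (hQ : IsGenerator P Q)
    (t : ℝ≥0) (j : E) :
    law μ X t j = ∑ i, law μ X 0 i * NormedSpace.exp ((t : ℝ) • Q) i j := by
  set y : ℝ → E → ℝ := fun r j => ∑ i, law μ X 0 i * NormedSpace.exp (r • Q) i j with hy
  have hyd : ∀ r, HasDerivAt y (Matrix.vecMul (y r) Q) r := fun r => by
    refine hasDerivAt_pi.2 fun j => ?_
    have := HasDerivAt.fun_sum (u := Finset.univ) fun i _ =>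
      (hasDerivAt_matrix_exp_apply Q i j r).const_mul (law μ X 0 i)
    convert this using 1
    simp only [Matrix.vecMul, dotProduct, hy, Matrix.mul_apply, Finset.sum_mul, Finset.mul_sum]
    rw [Finset.sum_comm]
    simp only [mul_assoc]
  -- Uniqueness for this Lipschitz linear equation needs only continuity and right derivatives.
  have huniq := ODE_solution_unique_of_mem_Icc_right (a := 0) (b := t)
    (v := fun _ z => Matrix.vecMul z Q) (s := fun _ => Set.univ)
    (f := fun r : ℝ => law μ X r.toNNReal) (g := y)
    (fun _ _ => ((Matrix.vecMulLinear Q).toContinuousLinearMap.lipschitz).lipschitzOnWith)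
    (continuous_pi fun j => (hX.continuous_law hQ j).comp continuous_real_toNNReal).continuousOn
    (fun r hr => hasDerivWithinAt_pi.2 fun j => hX.hasDerivWithinAt_law hQ hr.1 j)
    (fun _ _ => Set.mem_univ _)
    (fun r _ => (hyd r).continuousAt.continuousWithinAt)
    (fun r _ => (hyd r).hasDerivWithinAt) (fun _ _ => Set.mem_univ _)
    (by ext j; simp [hy, Matrix.one_apply])
  have := congrFun (huniq ⟨t.2, le_rfl⟩) j
  simpa using this

end Law

/-! ### Expected number of repairs and its derivative -/

section Repairs

lemma crossing_eq_sum_indicator {Ω E : Type*} [DecidableEq E] {X : ℝ≥0 → Ω → E}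
    (F W : Finset E) (a b : ℝ≥0) (ω : Ω) :
    (crossing (fun s => X s ω) F W a b : ℝ) = ∑ f ∈ F, ∑ w ∈ W,
      ({ω | X a ω = f} ∩ {ω | X b ω = w}).indicator (fun _ => (1 : ℝ)) ω := by
  simp only [Set.indicator_apply, Set.mem_inter_iff, Set.mem_ofPred_eq, crossing, ite_and,
    Finset.sum_ite_irrel, Finset.sum_const_zero, Finset.sum_ite_eq]
  split_ifs <;> simp

variable {Ω E : Type*} [MeasurableSpace Ω] [Fintype E] [DecidableEq E]
  {μ : Measure Ω} [IsProbabilityMeasure μ]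
  {X : ℝ≥0 → Ω → E} {P : ℝ≥0 → Matrix E E ℝ} {Q : Matrix E E ℝ}

lemma IsMarkovProcess.integrable_crossing (hX : IsMarkovProcess μ X P) (F W : Finset E)
    (a b : ℝ≥0) : Integrable (fun ω => (crossing (fun s => X s ω) F W a b : ℝ)) μ := by
  simp_rw [crossing_eq_sum_indicator]
  exact integrable_finsetSum _ fun f _ => integrable_finsetSum _ fun w _ =>
    (integrable_const _).indicator ((hX.measurableSet_eq _ _).inter (hX.measurableSet_eq _ _))

lemma IsMarkovProcess.integral_crossing (hX : IsMarkovProcess μ X P) (F W : Finset E)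
    (s h : ℝ≥0) : ∫ ω, (crossing (fun s => X s ω) F W s (s + h) : ℝ) ∂μ
      = ∑ f ∈ F, ∑ w ∈ W, law μ X s f * P h f w := by
  simp_rw [crossing_eq_sum_indicator]
  have hm : ∀ f w, MeasurableSet ({ω | X s ω = f} ∩ {ω | X (s + h) ω = w}) := fun f w =>
    (hX.measurableSet_eq _ _).inter (hX.measurableSet_eq _ _)
  rw [integral_finsetSum _ fun f _ => integrable_finsetSum _ fun w _ =>
    (integrable_const _).indicator (hm f w)]
  refine Finset.sum_congr rfl fun f _ => ?_
  rw [integral_finsetSum _ fun w _ => (integrable_const _).indicator (hm f w)]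
  refine Finset.sum_congr rfl fun w _ => ?_
  rw [integral_indicator_const _ (hm f w), hX.measureReal_inter, smul_eq_mul, mul_one]

/-- Bounding the law by `1` makes the error independent of `s`, so it can be summed over the grid.
-/
lemma IsMarkovProcess.abs_integral_crossing_sub_le (hX : IsMarkovProcess μ X P) (F W : Finset E)
    (s : ℝ≥0) {h : ℝ≥0} (hh : h ≠ 0) :
    |∫ ω, (crossing (fun s => X s ω) F W s (s + h) : ℝ) ∂μ
        - h * ∑ f ∈ F, ∑ w ∈ W, law μ X s f * Q f w|
      ≤ h * ∑ f ∈ F, ∑ w ∈ W, |P h f w / h - Q f w| := by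
  have hh' : (h : ℝ) ≠ 0 := by exact_mod_cast hh
  rw [hX.integral_crossing]
  simp only [Finset.mul_sum, ← Finset.sum_sub_distrib]
  refine (Finset.abs_sum_le_sum_abs _ _).trans (Finset.sum_le_sum fun f _ => ?_)
  refine (Finset.abs_sum_le_sum_abs _ _).trans (Finset.sum_le_sum fun w _ => ?_)
  rw [show law μ X s f * P h f w - h * (law μ X s f * Q f w)
    = law μ X s f * (h * (P h f w / h - Q f w)) by field_simp, abs_mul, abs_mul,
    abs_of_nonneg (law_nonneg _ _), abs_of_nonneg h.coe_nonneg]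
  exact mul_le_of_le_one_left (by positivity) (law_le_one _ _)

lemma IsMarkovProcess.integrable_gridCrossings (hX : IsMarkovProcess μ X P) (F W : Finset E)
    (h : ℝ≥0) (m : ℕ) :
    Integrable (fun ω => (gridCrossings (fun s => X s ω) F W h m : ℝ)) μ := by
  simp_rw [gridCrossings, Nat.cast_sum]
  exact integrable_finsetSum _ fun k _ => hX.integrable_crossing F W _ _

/-- The intensity of transitions from `F` to `W` at time `s`. -/
noncomputable def transitionRate (α : E → ℝ) (Q : Matrix E E ℝ) (F W : Finset E) (s : ℝ) : ℝ :=
  ∑ i, ∑ f ∈ F, ∑ w ∈ W, α i * NormedSpace.exp (s • Q) i f * Q f w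

lemma continuous_transitionRate (α : E → ℝ) (Q : Matrix E E ℝ) (F W : Finset E) :
    Continuous (transitionRate α Q F W) := by
  have : ∀ i j, Continuous fun s : ℝ => NormedSpace.exp (s • Q) i j := fun i j =>
    continuous_iff_continuousAt.2 fun s => (hasDerivAt_matrix_exp_apply Q i j s).continuousAt
  unfold transitionRate
  exact continuous_finsetSum _ fun i _ => continuous_finsetSum _ fun f _ =>
    continuous_finsetSum _ fun w _ => (continuous_const.mul (this i f)).mul continuous_const

lemma IsMarkovProcess.transitionRate_eq (hX : IsMarkovProcess μ X P) (hQ : IsGenerator P Q)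
    (F W : Finset E) (s : ℝ≥0) :
    transitionRate (law μ X 0) Q F W s = ∑ f ∈ F, ∑ w ∈ W, law μ X s f * Q f w := by
  simp_rw [hX.law_eq_exp hQ s, transitionRate, Finset.sum_mul]
  rw [Finset.sum_comm]
  refine Finset.sum_congr rfl fun f _ => Finset.sum_comm

lemma IsMarkovProcess.tendsto_integral_gridCrossings (hX : IsMarkovProcess μ X P)
    (hQ : IsGenerator P Q) {F W : Finset E} (hdisj : Disjoint W F) (t : ℝ≥0) :
    Tendsto (fun n : ℕ => ∫ ω, (gridCrossings (fun s => X s ω) F W (t / 2 ^ n) (2 ^ n) : ℝ) ∂μ)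
      atTop (𝓝 (∫ s in (0 : ℝ)..t, transitionRate (law μ X 0) Q F W s)) := by
  have hne : ∀ f ∈ F, ∀ w ∈ W, f ≠ w := fun f hf w hw h =>
    Finset.disjoint_left.1 hdisj hw (h ▸ hf)
  rcases eq_or_ne t 0 with rfl | ht
  -- For `t = 0` the mesh is zero and does not approach `0` from the right.
  · have hcr : ∀ ω, crossing (fun s => X s ω) F W 0 0 = 0 := fun ω =>
      if_neg fun h => hne _ h.1 _ h.2 rfl
    simp [gridCrossings, hcr]
  have hriem := tendsto_dyadic_riemann_sum
    (continuous_transitionRate (law μ X 0) Q F W) t.coe_nonneg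
  have hmesh : Tendsto (fun n : ℕ => t / 2 ^ n) atTop (𝓝[>] 0) := by
    refine tendsto_nhdsWithin_iff.2 ⟨?_, Eventually.of_forall fun n => ?_⟩
    · rw [← NNReal.tendsto_coe]
      simpa using tendsto_dyadic_mesh t
    · exact div_pos (pos_iff_ne_zero.2 ht) (by positivity)
  have herr : Tendsto (fun h : ℝ≥0 => ∑ f ∈ F, ∑ w ∈ W, |P h f w / h - Q f w|) (𝓝[>] 0) (𝓝 0) := by
    have : Tendsto (fun h : ℝ≥0 => ∑ f ∈ F, ∑ w ∈ W, |P h f w / h - Q f w|) (𝓝[>] 0)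
        (𝓝 (∑ f ∈ F, ∑ w ∈ W, |Q f w - Q f w|)) :=
      tendsto_finsetSum _ fun f hf => tendsto_finsetSum _ fun w hw =>
        ((hQ.tendsto_off_diag f w (hne f hf w hw)).sub_const _).abs
    simpa using this
  have hbound := (herr.comp hmesh).const_mul (t : ℝ)
  rw [mul_zero] at hbound
  have hdiff := squeeze_zero_norm (f := fun n : ℕ =>
    ∫ ω, (gridCrossings (fun s => X s ω) F W (t / 2 ^ n) (2 ^ n) : ℝ) ∂μ
      - ∑ k ∈ Finset.range (2 ^ n),
        (t : ℝ) / 2 ^ n * transitionRate (law μ X 0) Q F W (k * (t / 2 ^ n))) ?_ hbound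
  · simpa using hdiff.add hriem
  intro n
  have hh : t / 2 ^ n ≠ 0 := by positivity
  have hsum : (t : ℝ) = ∑ k ∈ Finset.range (2 ^ n), ((t / 2 ^ n : ℝ≥0) : ℝ) := by
    simp; field_simp
  simp_rw [gridCrossings, Nat.cast_sum]
  rw [integral_finsetSum _ fun k _ => hX.integrable_crossing F W _ _, ← Finset.sum_sub_distrib,
    Real.norm_eq_abs]
  refine (Finset.abs_sum_le_sum_abs _ _).trans ?_
  -- The steps add up to `t`, so the total error is `t` times a quantity vanishing with the mesh.
  rw [hsum, Finset.sum_mul]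
  refine Finset.sum_le_sum fun k _ => ?_
  have := hX.abs_integral_crossing_sub_le (Q := Q) F W (k * (t / 2 ^ n)) hh
  rw [← hX.transitionRate_eq hQ] at this
  rw [← add_one_mul] at this
  simpa using this

lemma IsMarkovProcess.integrable_numRepairs_and_integral_eq (hX : IsMarkovProcess μ X P)
    (hQ : IsGenerator P Q) {W F : Finset E} (hdisj : Disjoint W F)
    (hcover : W ∪ F = Finset.univ) (t : ℝ≥0) :
    Integrable (fun ω => (numRepairs X F W t ω : ℝ)) μ ∧
      ∫ ω, (numRepairs X F W t ω : ℝ) ∂μ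
        = ∫ s in (0 : ℝ)..t, transitionRate (law μ X 0) Q F W s := by
  refine integrable_and_integral_eq_of_monotone_tendsto
    (fun n => hX.integrable_gridCrossings F W (t / 2 ^ n) (2 ^ n)) (fun n ω => Nat.cast_nonneg _)
    (fun ω n m hnm => Nat.cast_le.2 (monotone_gridCrossings_dyadic _ hcover t hnm)) ?_
    (hX.tendsto_integral_gridCrossings hQ hdisj t)
  filter_upwards [hX.ae_cadlag] with ω hω
  refine tendsto_const_nhds.congr' ?_
  filter_upwards [hω.eventually_ncard_transitionTimes hdisj t] with n hn
  rw [numRepairs, hn]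

lemma IsMarkovProcess.hasROCOR (hX : IsMarkovProcess μ X P)
    (hQ : IsGenerator P Q) {W F : Finset E} (hdisj : Disjoint W F)
    (hcover : W ∪ F = Finset.univ) (t : ℝ≥0) :
    HasROCOR μ X F W t (transitionRate (law μ X 0) Q F W t) := by
  have hN := hX.integrable_numRepairs_and_integral_eq hQ hdisj hcover
  have hcont := continuous_transitionRate (law μ X 0) Q F W
  have hder := (hcont.integral_hasStrictDerivAt 0 t).hasDerivAt.tendsto_slope_zero
  -- The integral is differentiable on all of `ℝ`, so restricting to admissible increments covers
  -- the one-sided limit at `t = 0` too.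
  refine (hder.mono_left (nhdsWithin_mono _ fun Δ hΔ => hΔ.1)).congr' ?_
  filter_upwards [self_mem_nhdsWithin] with Δ hΔ
  rw [integral_sub (hN _).1 (hN _).1, (hN _).2, (hN _).2, Real.coe_toNNReal _ hΔ.2, smul_eq_mul,
    div_eq_inv_mul]

end Repairs

end MarkovReliability

theorem mainTheorem2 {Ω E : Type*} [MeasurableSpace Ω] [Fintype E] [DecidableEq E]
    (μ : Measure Ω) [IsProbabilityMeasure μ]
    (X : ℝ≥0 → Ω → E) (P : ℝ≥0 → Matrix E E ℝ) (Q : Matrix E E ℝ) (α : E → ℝ)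
    (hX : MarkovReliability.IsMarkovProcess μ X P)
    (hQ : MarkovReliability.IsGenerator P Q)
    (hα : ∀ i, α i = μ.real {ω | X 0 ω = i})
    (W F : Finset E) (hdisj : Disjoint W F) (hcover : W ∪ F = Finset.univ) :
    (∀ t : ℝ≥0, ∀ᵐ ω ∂μ,
      (MarkovReliability.transitionTimes (fun s => X s ω) F W t).Finite) ∧
    (∀ t : ℝ≥0, Integrable (fun ω => (MarkovReliability.numRepairs X F W t ω : ℝ)) μ) ∧
    (∀ t : ℝ≥0, MarkovReliability.HasROCOR μ X F W t
      (∑ i, ∑ f ∈ F, ∑ w ∈ W, α i * NormedSpace.exp ((t : ℝ) • Q) i f * Q f w)) := by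
  obtain rfl : α = MarkovReliability.law μ X 0 := funext hα
  exact ⟨fun t => hX.ae_cadlag.mono fun ω hω => hω.finite_transitionTimes hdisj t,
    fun t => (hX.integrable_numRepairs_and_integral_eq hQ hdisj hcover t).1,
    fun t => hX.hasROCOR hQ hdisj hcover t⟩
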